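/- Let $\mathbb{F}$ be an arbitrary field. An \emph{ACI-matrix} over $\mathbb{F}$ is a matrix whose entries are polynomials of degree at most one over $\mathbb{F}$ in some indeterminates, such that no indeterminate appears in two different columns. A \emph{completion} of it is the matrix over $\mathbb{F}$ obtained by assigning values in $\mathbb{F}$ to the indeterminates, and it has \emph{constant rank} $\rho$ if all its completions have rank $\rho$. Two $m\times n$ ACI-matrices $A$ and $B$ are \emph{equivalent}, $A\sim B$, if $TAQ=B$ for some nonsingular $m\times m$ matrix $T$ over $\mathbb{F}$ and some $n\times n$ permutation matrix $Q$. An ACI-matrix of constant rank $\rho$ is \emph{irreducible} if no matrix obtained from it by deleting a single row or a single column has constant rank $\rho$, and \emph{completely irreducible} if every ACI-matrix equivalent to it is irreducible. (Matrices with no rows or no columns are allowed; they have rank $0$.) Lemma. Every ACI-matrix $A$ of constant rank $\rho$ over $\mathbb{F}$ has a core: there is a completely irreducible ACI-matrix $A'$ of constant rank $\rho$ such that $$A\sim\begin{bmatrix} A' & * \\ * & * \end{bmatrix},$$ where the blocks other than $A'$ may be void. -/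

import Mathlib

namespace ACI

variable {F σ m n : Type*} [Field F]

/-- A matrix over `F[x_s : s ∈ σ]` is an ACI-matrix if its entries are polynomials of degree at
most one and no indeterminate appears in two different columns. -/
def IsACI (A : Matrix m n (MvPolynomial σ F)) : Prop :=
  (∀ i j, (A i j).totalDegree ≤ 1) ∧
    ∀ i i' j j', j ≠ j' → Disjoint (A i j).vars (A i' j').vars

/-- The completion of `A` given by assigning the value `x s` to each indeterminate `s`. -/
noncomputable def completion (A : Matrix m n (MvPolynomial σ F)) (x : σ → F) : Matrix m n F :=
  A.map (MvPolynomial.eval x)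

/-- The rank of `A`: the set of all ranks of completions of `A`. -/
def rankSet [Fintype n] (A : Matrix m n (MvPolynomial σ F)) : Set ℕ :=
  {r | ∃ x : σ → F, (completion A x).rank = r}

/-- `A` has constant rank `ρ`. -/
def HasConstantRank [Fintype n] (A : Matrix m n (MvPolynomial σ F)) (ρ : ℕ) : Prop :=
  rankSet A = {ρ}

/-- `A ∼ B`: there are a nonsingular constant matrix `T` and a permutation matrix `Q` such that
`T A Q = B`. -/
def Equivalent [Fintype m] [DecidableEq m] [Fintype n] [DecidableEq n]
    (A B : Matrix m n (MvPolynomial σ F)) : Prop :=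
  ∃ (T : Matrix m m F) (q : Equiv.Perm n), IsUnit T ∧
    (T.map MvPolynomial.C : Matrix m m (MvPolynomial σ F)) * A *
      (q.permMatrix (MvPolynomial σ F) : Matrix n n (MvPolynomial σ F)) = B

/-- The matrix obtained from `A` by deleting the row `i`. -/
def deleteRow (A : Matrix m n (MvPolynomial σ F)) (i : m) :
    Matrix {k : m // k ≠ i} n (MvPolynomial σ F) :=
  A.submatrix Subtype.val id

/-- The matrix obtained from `A` by deleting the column `j`. -/
def deleteCol (A : Matrix m n (MvPolynomial σ F)) (j : n) :
    Matrix m {k : n // k ≠ j} (MvPolynomial σ F) :=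
  A.submatrix id Subtype.val

/-- Row reducibility of a matrix `A` of constant rank `ρ`. -/
def RowReducible [Fintype n] (A : Matrix m n (MvPolynomial σ F)) (ρ : ℕ) : Prop :=
  HasConstantRank A ρ ∧ ∃ i, HasConstantRank (deleteRow A i) ρ

/-- Column reducibility of a matrix `A` of constant rank `ρ`. -/
def ColReducible [Fintype n] [DecidableEq n] (A : Matrix m n (MvPolynomial σ F)) (ρ : ℕ) : Prop :=
  HasConstantRank A ρ ∧ ∃ j, HasConstantRank (deleteCol A j) ρ

/-- `A` is an irreducible ACI-matrix of constant rank `ρ`. -/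
def IsIrreducible [Fintype n] [DecidableEq n] (A : Matrix m n (MvPolynomial σ F)) (ρ : ℕ) : Prop :=
  IsACI A ∧ HasConstantRank A ρ ∧ ¬ RowReducible A ρ ∧ ¬ ColReducible A ρ

/-- `A` is a completely irreducible ACI-matrix of constant rank `ρ`: every ACI-matrix equivalent
to `A` is irreducible. -/
def IsCompletelyIrreducible [Fintype m] [DecidableEq m] [Fintype n] [DecidableEq n]
    (A : Matrix m n (MvPolynomial σ F)) (ρ : ℕ) : Prop :=
  IsACI A ∧ HasConstantRank A ρ ∧ ∀ B, IsACI B → Equivalent A B → IsIrreducible B ρ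

/-- `A'` is the upper left `m' × n'` block of the `m × n` matrix `B`. -/
def IsUpperLeftBlock {m n m' n' : ℕ} (A' : Matrix (Fin m') (Fin n') (MvPolynomial σ F))
    (B : Matrix (Fin m) (Fin n) (MvPolynomial σ F)) : Prop :=
  ∃ (hm : m' ≤ m) (hn : n' ≤ n), A' = B.submatrix (Fin.castLE hm) (Fin.castLE hn)

/-- `A'` is a core of the matrix `A` of constant rank `ρ`: `A` is equivalent to an ACI-matrix with
upper left block `A'`, and `A'` is completely irreducible of constant rank `ρ`. -/
def IsCore {m n m' n' : ℕ} (A' : Matrix (Fin m') (Fin n') (MvPolynomial σ F))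
    (A : Matrix (Fin m) (Fin n) (MvPolynomial σ F)) (ρ : ℕ) : Prop :=
  (∃ B, IsACI B ∧ Equivalent A B ∧ IsUpperLeftBlock A' B) ∧ IsCompletelyIrreducible A' ρ

end ACI

/-- Two injections into types of the same finite cardinality differ by a bijection. -/
theorem Function.Injective.exists_equiv_apply_eq {α β γ : Type*} [Finite γ] (e₀ : β ≃ γ)
    {f : α → β} {g : α → γ} (hf : Function.Injective f) (hg : Function.Injective g) :
    ∃ e : β ≃ γ, ∀ a, e (f a) = g a := by
  classical
  have := Fintype.ofFinite γ
  have hf' : Function.Injective (e₀ ∘ f) := e₀.injective.comp hf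
  let u : {x // x ∈ Set.range (e₀ ∘ f)} ≃ {x // x ∈ Set.range g} :=
    (Equiv.ofInjective _ hf').symm.trans (Equiv.ofInjective _ hg)
  refine ⟨e₀.trans u.extendSubtype, fun a => ?_⟩
  have h := u.extendSubtype_apply_of_mem (e₀ (f a)) ⟨a, rfl⟩
  have ha : (Equiv.ofInjective _ hf').symm ⟨e₀ (f a), a, rfl⟩ = a :=
    Equiv.ofInjective_symm_apply hf' a
  rw [Equiv.trans_apply, h]
  simp [u, ha]

namespace ACI

open Matrix

/-- `A'` is obtained from `A` by passing to `R A`, where the constant matrix `R` has a right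
inverse, and selecting distinct columns of the result. -/
def IsCompression {F σ : Type*} [Field F] {m n m' n' : ℕ}
    (A' : Matrix (Fin m') (Fin n') (MvPolynomial σ F))
    (A : Matrix (Fin m) (Fin n) (MvPolynomial σ F)) : Prop :=
  ∃ (R : Matrix (Fin m') (Fin m) F) (S : Matrix (Fin m) (Fin m') F) (c : Fin n' → Fin n),
    R * S = 1 ∧ Function.Injective c ∧
      A' = ((R.map MvPolynomial.C : Matrix _ _ (MvPolynomial σ F)) * A).submatrix id c

section

variable {F σ : Type*} [Field F] {m n m' n' m'' n'' : ℕ}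
  {A : Matrix (Fin m) (Fin n) (MvPolynomial σ F)}
  {A' : Matrix (Fin m') (Fin n') (MvPolynomial σ F)}
  {A'' : Matrix (Fin m'') (Fin n'') (MvPolynomial σ F)}

theorem IsCompression.refl (A : Matrix (Fin m) (Fin n) (MvPolynomial σ F)) :
    IsCompression A A :=
  ⟨1, 1, id, by simp, Function.injective_id, by
    rw [Matrix.map_one _ (map_zero _) (map_one _)]; simp⟩

theorem IsCompression.trans (h' : IsCompression A'' A') (h : IsCompression A' A) :
    IsCompression A'' A := by
  obtain ⟨R, S, c, hRS, hc, rfl⟩ := h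
  obtain ⟨R', S', c', hRS', hc', rfl⟩ := h'
  refine ⟨R' * R, S * S', c ∘ c', ?_, hc.comp hc', ?_⟩
  · rw [Matrix.mul_assoc, ← Matrix.mul_assoc R, hRS, Matrix.one_mul, hRS']
  · rw [Matrix.map_mul, Matrix.mul_assoc]
    rfl

theorem IsCompression.isACI (h : IsCompression A' A) (hA : IsACI A) : IsACI A' := by
  classical
  obtain ⟨R, S, c, -, hc, rfl⟩ := h
  have hvars : ∀ i j, (((R.map MvPolynomial.C : Matrix _ _ (MvPolynomial σ F)) * A) i j).vars ⊆
      Finset.univ.biUnion fun k => (A k j).vars := by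
    intro i j
    rw [Matrix.mul_apply]
    refine (MvPolynomial.vars_sum_subset _ _).trans (Finset.biUnion_mono fun k _ => ?_)
    refine (MvPolynomial.vars_mul _ _).trans ?_
    simp
  constructor
  · intro i j
    rw [Matrix.submatrix_apply, Matrix.mul_apply]
    refine MvPolynomial.totalDegree_finsetSum_le fun k _ => ?_
    refine (MvPolynomial.totalDegree_mul _ _).trans ?_
    simpa using hA.1 k (c j)
  · intro i i' j j' hj
    refine Finset.disjoint_of_subset_left (hvars _ _)
      (Finset.disjoint_of_subset_right (hvars _ _) ?_)
    simp only [Finset.disjoint_biUnion_left, Finset.disjoint_biUnion_right]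
    exact fun k _ k' _ => hA.2 _ _ _ _ (hc.ne hj)

theorem Equivalent.exists_submatrix {B : Matrix (Fin m) (Fin n) (MvPolynomial σ F)}
    (h : Equivalent A B) :
    ∃ (T : Matrix (Fin m) (Fin m) F) (q : Equiv.Perm (Fin n)), IsUnit T ∧
      B = ((T.map MvPolynomial.C : Matrix _ _ (MvPolynomial σ F)) * A).submatrix id q := by
  obtain ⟨T, q, hT, rfl⟩ := h
  exact ⟨T, q.symm, hT, PEquiv.mul_toMatrix_toPEquiv _ _⟩

theorem Equivalent.isCompression {B : Matrix (Fin m) (Fin n) (MvPolynomial σ F)}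
    (h : Equivalent A B) : IsCompression B A := by
  obtain ⟨T, q, hT, rfl⟩ := h.exists_submatrix
  exact ⟨T, T⁻¹, q, Matrix.mul_nonsing_inv _ ((Matrix.isUnit_iff_isUnit_det _).1 hT),
    q.injective, rfl⟩

theorem Equivalent.rank_completion {B : Matrix (Fin m) (Fin n) (MvPolynomial σ F)}
    (h : Equivalent A B) (x : σ → F) : (completion B x).rank = (completion A x).rank := by
  obtain ⟨T, q, hT, rfl⟩ := h.exists_submatrix
  have hx : completion (((T.map MvPolynomial.C : Matrix _ _ (MvPolynomial σ F)) * A).submatrix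
      id q) x = (T * completion A x).submatrix (Equiv.refl _) q := by
    ext i j
    simp [completion, Matrix.mul_apply]
  rw [hx, Matrix.rank_submatrix, Matrix.rank_mul_eq_right_of_isUnit_det]
  exact (Matrix.isUnit_iff_isUnit_det _).1 hT

theorem Equivalent.hasConstantRank {B : Matrix (Fin m) (Fin n) (MvPolynomial σ F)} {ρ : ℕ}
    (h : Equivalent A B) (hA : HasConstantRank A ρ) : HasConstantRank B ρ := by
  simpa only [HasConstantRank, rankSet, h.rank_completion] using hA

theorem HasConstantRank.submatrix_equiv {k l k' l' : Type*} [Fintype l] [Fintype l']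
    {M : Matrix k l (MvPolynomial σ F)} {ρ : ℕ} (h : HasConstantRank M ρ)
    (e : k' ≃ k) (f : l' ≃ l) : HasConstantRank (M.submatrix e f) ρ := by
  have hx : ∀ x : σ → F, (completion (M.submatrix e f) x).rank = (completion M x).rank :=
    fun x => Matrix.rank_submatrix (completion M x) e f
  simpa only [HasConstantRank, rankSet, hx] using h

theorem isCompression_submatrix {r : Fin m' → Fin m} {c : Fin n' → Fin n}
    (hr : Function.Injective r) (hc : Function.Injective c) :
    IsCompression (A.submatrix r c) A := by
  refine ⟨(1 : Matrix _ _ F).submatrix r id, (1 : Matrix _ _ F).submatrix id r, c, ?_, hc, ?_⟩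
  · ext i j
    simp [Matrix.mul_apply, Matrix.one_apply, hr.eq_iff]
  · ext1 i j
    simp [Matrix.mul_apply, Matrix.one_apply, apply_ite]

theorem exists_isUnit_submatrix_castLE {R : Matrix (Fin m') (Fin m) F}
    (hR : LinearIndependent F R.row) (hm : m' ≤ m) :
    ∃ T : Matrix (Fin m) (Fin m) F, IsUnit T ∧ T.submatrix (Fin.castLE hm) id = R := by
  let b := Module.Basis.sumExtend hR
  have : Fintype (Fin m' ⊕ Module.Basis.sumExtendIndex hR) :=
    FiniteDimensional.fintypeBasisIndex b
  have hcard : Fintype.card (Fin m) = Fintype.card (Fin m' ⊕ Module.Basis.sumExtendIndex hR) := by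
    rw [← Module.finrank_eq_card_basis b, Module.finrank_fin_fun, Fintype.card_fin]
  obtain ⟨g, hg⟩ := (Fin.castLE_injective hm).exists_equiv_apply_eq
    (Fintype.equivOfCardEq hcard) (Sum.inl_injective (β := Module.Basis.sumExtendIndex hR))
  refine ⟨Matrix.of fun i => b (g i), ?_, ?_⟩
  · rw [← Matrix.linearIndependent_rows_iff_isUnit]
    exact b.linearIndependent.comp g g.injective
  · ext i j
    simp [hg, b, Module.Basis.sumExtend]
    rfl

theorem IsCompression.exists_isUpperLeftBlock (h : IsCompression A' A) :
    ∃ B, Equivalent A B ∧ IsUpperLeftBlock A' B := by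
  obtain ⟨R, S, c, hRS, hc, rfl⟩ := h
  have hR : LinearIndependent F R.row := by
    rw [← Matrix.vecMul_injective_iff]
    intro v w hvw
    have := congrArg (fun u => u ᵥ* S) hvw
    simpa [Matrix.vecMul_vecMul, hRS] using this
  have hm : m' ≤ m := by simpa using hR.fintype_card_le_finrank
  have hn : n' ≤ n := by simpa using Fintype.card_le_of_injective c hc
  obtain ⟨T, hT, hTR⟩ := exists_isUnit_submatrix_castLE hR hm
  obtain ⟨q, hq⟩ := (Fin.castLE_injective hn).exists_equiv_apply_eq (Equiv.refl _) hc
  refine ⟨_, ⟨T, q.symm, hT, rfl⟩, hm, hn, ?_⟩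
  rw [Equiv.Perm.permMatrix, PEquiv.mul_toMatrix_toPEquiv, ← hTR]
  ext1 i j
  simp [Matrix.mul_apply, hq]

/-- An ACI-matrix of constant rank that is not completely irreducible has a compression of the
same constant rank with fewer rows or fewer columns. -/
theorem exists_smaller_isCompression {ρ : ℕ} (hA : IsACI A) (hρ : HasConstantRank A ρ)
    (h : ¬ IsCompletelyIrreducible A ρ) :
    ∃ (k l : ℕ) (D : Matrix (Fin k) (Fin l) (MvPolynomial σ F)),
      k + l < m + n ∧ IsCompression D A ∧ HasConstantRank D ρ := by
  obtain ⟨B, hB, hAB, hirr⟩ : ∃ B, IsACI B ∧ Equivalent A B ∧ ¬ IsIrreducible B ρ := by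
    by_contra! hcon
    exact h ⟨hA, hρ, hcon⟩
  have hred : RowReducible B ρ ∨ ColReducible B ρ := by
    by_contra! hcon
    exact hirr ⟨hB, hAB.hasConstantRank hρ, hcon⟩
  rcases hred with ⟨-, i, hi⟩ | ⟨-, j, hj⟩
  · cases m with
    | zero => exact i.elim0
    | succ m =>
      refine ⟨m, n, B.submatrix i.succAbove id, by omega, ?_, ?_⟩
      · exact (isCompression_submatrix i.succAbove_right_injective
          Function.injective_id).trans hAB.isCompression
      · exact hi.submatrix_equiv (finSuccAboveEquiv i) (Equiv.refl _)
  · cases n with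
    | zero => exact j.elim0
    | succ n =>
      refine ⟨m, n, B.submatrix id j.succAbove, by omega, ?_, ?_⟩
      · exact (isCompression_submatrix Function.injective_id
          j.succAbove_right_injective).trans hAB.isCompression
      · exact hj.submatrix_equiv (Equiv.refl _) (finSuccAboveEquiv j)

end

theorem exists_isCompression_isCompletelyIrreducible {F σ : Type*} [Field F] {ρ : ℕ} {m n : ℕ}
    (A : Matrix (Fin m) (Fin n) (MvPolynomial σ F)) (hA : IsACI A) (hρ : HasConstantRank A ρ) :
    ∃ (m' n' : ℕ) (A' : Matrix (Fin m') (Fin n') (MvPolynomial σ F)),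
      IsCompression A' A ∧ IsCompletelyIrreducible A' ρ := by
  by_cases h : IsCompletelyIrreducible A ρ
  · exact ⟨m, n, A, IsCompression.refl A, h⟩
  · obtain ⟨k, l, D, hlt, hDA, hD⟩ := exists_smaller_isCompression hA hρ h
    obtain ⟨m', n', A', hA', hirr⟩ :=
      exists_isCompression_isCompletelyIrreducible D (hDA.isACI hA) hD
    exact ⟨m', n', A', hA'.trans hDA, hirr⟩
termination_by m + n

end ACI

theorem mainTheorem4 {F σ : Type*} [Field F] {m n : ℕ} (ρ : ℕ)
    (A : Matrix (Fin m) (Fin n) (MvPolynomial σ F))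
    (hA : ACI.IsACI A) (hρ : ACI.HasConstantRank A ρ) :
    ∃ (m' n' : ℕ) (A' : Matrix (Fin m') (Fin n') (MvPolynomial σ F)), ACI.IsCore A' A ρ := by
  obtain ⟨m', n', A', hA', hirr⟩ := ACI.exists_isCompression_isCompletelyIrreducible A hA hρ
  obtain ⟨B, hAB, hblock⟩ := hA'.exists_isUpperLeftBlock
  exact ⟨m', n', A', ⟨B, hAB.isCompression.isACI hA, hAB, hblock⟩, hirr⟩
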